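/- Let $0<p<1$ and $q:=1-p$. For $n\ge 1$ let $Z_1,\dots,Z_n$ be independent random variables with the geometric distribution $\mathbb P(Z_m=i)=p\,q^{i-1}$, $i\in\mathbb N=\{1,2,3,\dots\}$. For $i\in\mathbb N$ let $X_{i,i}^{(n)}$ be the indicator (with value $1$ if the event occurs and $0$ otherwise) of the event that the pair $(i,i)$ appears at least once as a consecutive pair of the string, i.e. that $Z_m=Z_{m+1}=i$ for some $1\le m\le n-1$. Then the random variables $X_{i,i}^{(n)}$, $i\in\mathbb N$, are asymptotically independent in the following sense: for every integer $k\ge 0$ there is a constant $C_k$, depending only on $k$, such that for every $p\in(0,1)$, every $I\subseteq\mathbb N$ of size $k$, every $(x_i)_{i\in I}\in\{0,1\}^I$ and every $n\ge 1$, $$\Bigl|\mathbb P\bigl(X_{i,i}^{(n)}=x_i,\ i\in I\bigr)-\prod_{i\in I}\mathbb P\bigl(X_{i,i}^{(n)}=x_i\bigr)\Bigr|\le\frac{C_k}{n}.$$ -/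

import Mathlib

open MeasureTheory ProbabilityTheory

/-- The ordered pair `(i, j)` occurs at least once as a pair of consecutive letters of the
string `z` of length `n`. -/
def PairAppears {n : ℕ} (z : Fin n → ℕ) (i j : ℕ) : Prop :=
  ∃ a b : Fin n, (b : ℕ) = (a : ℕ) + 1 ∧ z a = i ∧ z b = j

open Classical in
/-- The random variable `X_{i,j}^{(n)}`: the `0`-`1` indicator of the event that the pair `(i, j)`
appears in the random string `Z` of length `n`. -/
noncomputable def pairIndicator {Ω : Type*} {n : ℕ} (Z : Fin n → Ω → ℕ) (i j : ℕ) (ω : Ω) : ℕ :=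
  if PairAppears (fun m => Z m ω) i j then 1 else 0

/-- `Z` is a string of `n` independent random letters, each geometrically distributed on
`{1, 2, 3, …}` with parameter `p`: the letter `i ≥ 1` has probability `p (1 - p) ^ (i - 1)`. -/
structure IsGeometricString {Ω : Type*} [MeasurableSpace Ω] (μ : Measure Ω) (p : ℝ) {n : ℕ}
    (Z : Fin n → Ω → ℕ) : Prop where
  measurable : ∀ m, Measurable (Z m)
  indep : iIndepFun Z μ
  law : ∀ m, ∀ i : ℕ, 1 ≤ i → μ.real {ω | Z m ω = i} = p * (1 - p) ^ (i - 1)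

/-! Let `f_A(n)` be the probability that no `ii` with `i ∈ A` occurs, and `σ_A` the sum of `w i ^ 2`
over `A`. Conditioning on the last letter gives a linear recursion for `f_A`, hence `f_A(n) ≤ exp
(-σ_A (n - 1) / 2)`. For disjoint `A`, `B`, the product `f_A f_B` nearly solves the recursion of
`f_(A ∪ B)`: its defect at time `k` is `O(σ_A σ_B exp (-l k / 2))`, `l = σ_A + σ_B`
(`abs_avoidDefect_mul_le`). Variation of constants (`sub_avoidProb_eq_sum_avoidDefect`) then bounds
`f_A f_B - f_(A ∪ B)` by a multiple of `n l² exp (-l n / 2)`, which is `O(1 / n)` uniformly in `l`,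
hence in `p`. This needs all weights at most `1/2`; with a heavier letter both terms are already
`O(1 / n)`.

Splitting off one letter at a time handles the events "all `X_{i,i} = 0`"; `real_noRepeat` ties them
to the recursion, and inclusion-exclusion yields arbitrary values. -/

/-- For independent letters with weights `w`, the first component is the probability that a string
of length `n` has no repeated pair `ii` with `i ∈ A`; the second component, at `i ∈ A`, is the
probability that moreover the string ends with the letter `i`. -/
noncomputable def avoidPair (w : ℕ → ℝ) (A : Finset ℕ) : ℕ → ℝ × (ℕ → ℝ)
  | 0 => (1, 0)
  | n + 1 => ((avoidPair w A n).1 - ∑ i ∈ A, w i * (avoidPair w A n).2 i,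
      fun i => w i * ((avoidPair w A n).1 - (avoidPair w A n).2 i))

/-- The probability that a string of length `n` has no repeated pair `ii` with `i ∈ A`. -/
noncomputable def avoidProb (w : ℕ → ℝ) (A : Finset ℕ) (n : ℕ) : ℝ := (avoidPair w A n).1

/-- The probability that a string of length `n` ends with `i` and has no repeated pair in `A`. -/
noncomputable def avoidEnd (w : ℕ → ℝ) (A : Finset ℕ) (n i : ℕ) : ℝ := (avoidPair w A n).2 i

/-! ### The avoidance recursion: positivity, exponential decay, perturbation. -/

section Recursion

variable {w : ℕ → ℝ} {A B : Finset ℕ}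

@[simp] lemma avoidProb_zero : avoidProb w A 0 = 1 := rfl

@[simp] lemma avoidEnd_zero (i : ℕ) : avoidEnd w A 0 i = 0 := rfl

lemma avoidProb_succ (n : ℕ) :
    avoidProb w A (n + 1) = avoidProb w A n - ∑ i ∈ A, w i * avoidEnd w A n i := rfl

lemma avoidEnd_succ (n i : ℕ) :
    avoidEnd w A (n + 1) i = w i * (avoidProb w A n - avoidEnd w A n i) := rfl

lemma avoidProb_one : avoidProb w A 1 = 1 := by simp [avoidProb_succ]

lemma avoid_invariants (hw : ∀ i ∈ A, 0 ≤ w i) (hs : ∑ i ∈ A, w i ≤ 1) (n : ℕ) :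
    (∀ i ∈ A, 0 ≤ avoidEnd w A n i) ∧ ∑ i ∈ A, avoidEnd w A n i ≤ avoidProb w A n := by
  induction n with
  | zero => simp
  | succ n ih =>
    obtain ⟨h0, h1⟩ := ih
    have hle : ∀ i ∈ A, avoidEnd w A n i ≤ avoidProb w A n := fun i hi =>
      (Finset.single_le_sum h0 hi).trans h1
    have hf : 0 ≤ avoidProb w A n := (Finset.sum_nonneg h0).trans h1
    refine ⟨fun i hi => ?_, ?_⟩
    · rw [avoidEnd_succ]
      exact mul_nonneg (hw i hi) (sub_nonneg.2 (hle i hi))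
    · simp only [avoidEnd_succ, avoidProb_succ, mul_sub, Finset.sum_sub_distrib, ← Finset.sum_mul]
      nlinarith

lemma avoidEnd_nonneg (hw : ∀ i ∈ A, 0 ≤ w i) (hs : ∑ i ∈ A, w i ≤ 1) (n : ℕ) {i : ℕ}
    (hi : i ∈ A) : 0 ≤ avoidEnd w A n i :=
  (avoid_invariants hw hs n).1 i hi

lemma avoidEnd_le (hw : ∀ i ∈ A, 0 ≤ w i) (hs : ∑ i ∈ A, w i ≤ 1) (n : ℕ) {i : ℕ}
    (hi : i ∈ A) : avoidEnd w A n i ≤ avoidProb w A n :=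
  (Finset.single_le_sum (avoid_invariants hw hs n).1 hi).trans (avoid_invariants hw hs n).2

lemma avoidProb_nonneg (hw : ∀ i ∈ A, 0 ≤ w i) (hs : ∑ i ∈ A, w i ≤ 1) (n : ℕ) :
    0 ≤ avoidProb w A n :=
  (Finset.sum_nonneg (avoid_invariants hw hs n).1).trans (avoid_invariants hw hs n).2

lemma avoidProb_succ_le (hw : ∀ i ∈ A, 0 ≤ w i) (hs : ∑ i ∈ A, w i ≤ 1) (n : ℕ) :
    avoidProb w A (n + 1) ≤ avoidProb w A n := by
  rw [avoidProb_succ]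
  linarith [Finset.sum_nonneg fun i hi => mul_nonneg (hw i hi) (avoidEnd_nonneg hw hs n hi)]

lemma avoidProb_le_one (hw : ∀ i ∈ A, 0 ≤ w i) (hs : ∑ i ∈ A, w i ≤ 1) (n : ℕ) :
    avoidProb w A n ≤ 1 := by
  induction n with
  | zero => simp
  | succ n ih => exact (avoidProb_succ_le hw hs n).trans ih

/-- A first repeat at the last two letters costs `w i ^ 2`, and the `n` earlier letters must still
be repeat-free. -/
lemma avoidProb_sub_succ_succ_le (hw : ∀ i ∈ A, 0 ≤ w i) (hs : ∑ i ∈ A, w i ≤ 1) (n : ℕ) :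
    avoidProb w A (n + 1) - avoidProb w A (n + 2) ≤ (∑ i ∈ A, w i ^ 2) * avoidProb w A n := by
  rw [avoidProb_succ (n + 1), sub_sub_cancel, Finset.sum_mul]
  refine Finset.sum_le_sum fun i hi => ?_
  rw [avoidEnd_succ]
  nlinarith [mul_nonneg (sq_nonneg (w i)) (avoidEnd_nonneg hw hs n hi)]

/-- The last two letters are independent of the first `n` and must not form a forbidden pair; the
discarded slack is `key`. -/
lemma avoidProb_add_two_le (hw : ∀ i ∈ A, 0 ≤ w i) (hs : ∑ i ∈ A, w i ≤ 1) (n : ℕ) :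
    avoidProb w A (n + 2) ≤ (1 - ∑ i ∈ A, w i ^ 2) * avoidProb w A n := by
  have key : 0 ≤ ∑ i ∈ A, w i * (1 - w i) * avoidEnd w A n i := by
    refine Finset.sum_nonneg fun i hi => mul_nonneg (mul_nonneg (hw i hi) ?_)
      (avoidEnd_nonneg hw hs n hi)
    linarith [Finset.single_le_sum hw hi]
  have e : ∑ i ∈ A, w i * avoidEnd w A (n + 1) i
      = (∑ i ∈ A, w i ^ 2) * avoidProb w A n - ∑ i ∈ A, w i * avoidEnd w A n i
        + ∑ i ∈ A, w i * (1 - w i) * avoidEnd w A n i := by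
    rw [Finset.sum_mul, ← Finset.sum_sub_distrib, ← Finset.sum_add_distrib]
    refine Finset.sum_congr rfl fun i _ => ?_
    rw [avoidEnd_succ]; ring
  rw [avoidProb_succ (n + 1), e, avoidProb_succ n]
  linarith

lemma avoidProb_le_exp (hw : ∀ i ∈ A, 0 ≤ w i) (hs : ∑ i ∈ A, w i ≤ 1) (n : ℕ) :
    avoidProb w A n ≤ Real.exp (-(∑ i ∈ A, w i ^ 2) * ((n : ℝ) - 1) / 2) := by
  have hσ : 0 ≤ ∑ i ∈ A, w i ^ 2 := Finset.sum_nonneg fun i _ => sq_nonneg _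
  induction n using Nat.strong_induction_on with
  | _ n ih =>
    match n with
    | 0 => simpa using by positivity
    | 1 => simp [avoidProb_one]
    | n + 2 =>
      calc avoidProb w A (n + 2) ≤ (1 - ∑ i ∈ A, w i ^ 2) * avoidProb w A n :=
            avoidProb_add_two_le hw hs n
        _ ≤ Real.exp (-∑ i ∈ A, w i ^ 2) * avoidProb w A n := by
            gcongr
            · exact avoidProb_nonneg hw hs n
            · exact Real.one_sub_le_exp_neg _
        _ ≤ Real.exp (-∑ i ∈ A, w i ^ 2)
              * Real.exp (-(∑ i ∈ A, w i ^ 2) * ((n : ℝ) - 1) / 2) := by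
            gcongr
            exact ih n (by omega)
        _ = _ := by
            rw [← Real.exp_add]; push_cast; congr 1; ring

/-- The solution of `b (n + 1) = c * (u n - b n)`, `b 0 = 0`. -/
noncomputable def alternatingTail (u : ℕ → ℝ) (c : ℝ) : ℕ → ℝ
  | 0 => 0
  | n + 1 => c * (u n - alternatingTail u c n)

/-- The defect of a sequence `u` in the recursion satisfied by `avoidProb w A`. -/
noncomputable def avoidDefect (w : ℕ → ℝ) (A : Finset ℕ) (u : ℕ → ℝ) (n : ℕ) : ℝ :=
  u (n + 1) - u n + ∑ i ∈ A, w i * alternatingTail u (w i) n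

/-- Discrete Duhamel formula: the defect injected at step `k` evolves linearly like a fresh string
of length `n - 1 - k`. -/
lemma sub_avoidProb_eq_sum_avoidDefect (u : ℕ → ℝ) (hu : u 0 = 1) (n : ℕ) :
    u n - avoidProb w A n
        = ∑ k ∈ Finset.range n, avoidDefect w A u k * avoidProb w A (n - 1 - k) ∧
      ∀ i, alternatingTail u (w i) n - avoidEnd w A n i
        = ∑ k ∈ Finset.range n, avoidDefect w A u k * avoidEnd w A (n - 1 - k) i := by
  induction n with
  | zero => simp [hu, alternatingTail]
  | succ n ih =>
    obtain ⟨h1, h2⟩ := ih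
    have hidx : ∀ k ∈ Finset.range n, n + 1 - 1 - k = (n - 1 - k) + 1 := fun k hk => by
      have := Finset.mem_range.1 hk
      omega
    constructor
    · rw [Finset.sum_range_succ, Finset.sum_congr rfl fun k hk => by
        rw [hidx k hk, avoidProb_succ, mul_sub, Finset.mul_sum]]
      rw [Finset.sum_sub_distrib, ← h1, Finset.sum_comm]
      have e : ∀ i ∈ A, ∑ k ∈ Finset.range n,
          avoidDefect w A u k * (w i * avoidEnd w A (n - 1 - k) i)
          = w i * alternatingTail u (w i) n - w i * avoidEnd w A n i := fun i _ => by
        rw [← mul_sub, h2, Finset.mul_sum]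
        exact Finset.sum_congr rfl fun k _ => by ring
      rw [Finset.sum_congr rfl e, Finset.sum_sub_distrib]
      simp only [add_tsub_cancel_right, tsub_self, avoidProb_zero, avoidDefect, avoidProb_succ]
      ring
    · intro i
      rw [Finset.sum_range_succ, Finset.sum_congr rfl fun k hk => by
        rw [hidx k hk, avoidEnd_succ, mul_left_comm, mul_sub]]
      rw [← Finset.mul_sum, Finset.sum_sub_distrib, ← h1, ← h2, avoidEnd_succ, alternatingTail]
      simp
      ring

end Recursion

/-! ### Approximate multiplicativity over disjoint sets of letters. -/

section Product

variable {w : ℕ → ℝ} {A B : Finset ℕ}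

/-- The defect has two sources: tails driven by the product differ from the products of tails, and
the discrete product rule leaves a cross term. -/
lemma avoidDefect_mul (hAB : Disjoint A B) (n : ℕ) :
    avoidDefect w (A ∪ B) (fun n => avoidProb w A n * avoidProb w B n) n
      = ∑ i ∈ A, w i * (alternatingTail (fun n => avoidProb w A n * avoidProb w B n) (w i) n
            - avoidEnd w A n i * avoidProb w B n)
        + ∑ i ∈ B, w i * (alternatingTail (fun n => avoidProb w A n * avoidProb w B n) (w i) n
            - avoidEnd w B n i * avoidProb w A n)
        + (avoidProb w A n - avoidProb w A (n + 1))
          * (avoidProb w B n - avoidProb w B (n + 1)) := by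
  rw [avoidDefect, Finset.sum_union hAB]
  simp only [mul_sub, Finset.sum_sub_distrib, ← mul_assoc, ← Finset.sum_mul, avoidProb_succ]
  ring

lemma avoidProb_mul_le (hwA : ∀ i ∈ A, 0 ≤ w i) (hA : ∑ i ∈ A, w i ≤ 1)
    (hwB : ∀ i ∈ B, 0 ≤ w i) (hB : ∑ i ∈ B, w i ≤ 1)
    {l : ℝ} (hl : l = ∑ i ∈ A, w i ^ 2 + ∑ i ∈ B, w i ^ 2) (n : ℕ) :
    avoidProb w A n * avoidProb w B n ≤ Real.exp (-l * ((n : ℝ) - 1) / 2) := by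
  calc _ ≤ Real.exp (-(∑ i ∈ A, w i ^ 2) * ((n : ℝ) - 1) / 2)
        * Real.exp (-(∑ i ∈ B, w i ^ 2) * ((n : ℝ) - 1) / 2) :=
        mul_le_mul (avoidProb_le_exp hwA hA n) (avoidProb_le_exp hwB hB n)
          (avoidProb_nonneg hwB hB n) (Real.exp_pos _).le
    _ = _ := by rw [← Real.exp_add, hl]; congr 1; ring

lemma exp_quarter_le : Real.exp (1 / 4) ≤ 4 / 3 := by
  have h := Real.one_sub_le_exp_neg (1 / 4)
  have h2 := Real.exp_pos (1 / 4)
  have h3 : Real.exp (-(1 / 4)) * Real.exp (1 / 4) = 1 := by rw [← Real.exp_add]; simp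
  nlinarith

lemma exp_le_two {l : ℝ} (hl2 : l ≤ 1 / 2) : Real.exp l ≤ 2 := by
  have := exp_quarter_le
  calc Real.exp l ≤ Real.exp (1 / 4 + 1 / 4) := Real.exp_le_exp.2 (by linarith)
    _ ≤ 2 := by rw [Real.exp_add]; nlinarith [Real.exp_pos (1 / 4)]

lemma exp_shift_le {l : ℝ} (hl2 : l ≤ 1 / 2) (m : ℕ) :
    Real.exp (-l * ((m : ℝ) - 1) / 2) ≤ 2 * Real.exp (-l * (m + 1 : ℕ) / 2) := by
  calc Real.exp (-l * ((m : ℝ) - 1) / 2)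
      = Real.exp l * Real.exp (-l * (m + 1 : ℕ) / 2) := by
        rw [← Real.exp_add]; push_cast; congr 1; ring
    _ ≤ _ := by
        gcongr
        exact exp_le_two hl2

/-- The error obeys a recursion with multiplier `-w i` and a forcing term containing one decrement
of `avoidProb w B`, which supplies the factor `τ`. -/
lemma abs_alternatingTail_sub_le (hwA : ∀ i ∈ A, 0 ≤ w i) (hA : ∑ i ∈ A, w i ≤ 1)
    (hwB : ∀ i ∈ B, 0 ≤ w i) (hB : ∑ i ∈ B, w i ≤ 1)
    {l : ℝ} (hl : l = ∑ i ∈ A, w i ^ 2 + ∑ i ∈ B, w i ^ 2) (hl2 : l ≤ 1 / 2)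
    {i : ℕ} (hi : i ∈ A) (hi2 : w i ≤ 1 / 2) (n : ℕ) :
    |alternatingTail (fun n => avoidProb w A n * avoidProb w B n) (w i) n
        - avoidEnd w A n i * avoidProb w B n|
      ≤ 8 * w i * (∑ i ∈ B, w i ^ 2) * Real.exp (-l * n / 2) := by
  set σ := ∑ i ∈ A, w i ^ 2
  set τ := ∑ i ∈ B, w i ^ 2 with hτ
  have hσ0 : 0 ≤ σ := Finset.sum_nonneg fun i _ => sq_nonneg _
  have hτ0 : 0 ≤ τ := Finset.sum_nonneg fun i _ => sq_nonneg _
  have hw := hwA i hi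
  have hstep : ∀ m : ℕ, Real.exp (-l * m / 2) ≤ 4 / 3 * Real.exp (-l * (m + 1 : ℕ) / 2) := by
    intro m
    calc Real.exp (-l * m / 2) = Real.exp (l / 2) * Real.exp (-l * (m + 1 : ℕ) / 2) := by
          rw [← Real.exp_add]; push_cast; congr 1; ring
      _ ≤ _ := by
          gcongr
          exact (Real.exp_le_exp.2 (by linarith)).trans exp_quarter_le
  induction n with
  | zero => simp [alternatingTail]; positivity
  | succ n ih =>
    have e : alternatingTail (fun n => avoidProb w A n * avoidProb w B n) (w i) (n + 1)
        - avoidEnd w A (n + 1) i * avoidProb w B (n + 1)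
        = w i * ((avoidProb w A n - avoidEnd w A n i)
              * (avoidProb w B n - avoidProb w B (n + 1))
            - (alternatingTail (fun n => avoidProb w A n * avoidProb w B n) (w i) n
              - avoidEnd w A n i * avoidProb w B n)) := by
      rw [avoidEnd_succ, alternatingTail]; ring
    have h1 : 0 ≤ avoidProb w A n - avoidEnd w A n i := sub_nonneg.2 (avoidEnd_le hwA hA n hi)
    have h2 : 0 ≤ avoidProb w B n - avoidProb w B (n + 1) :=
      sub_nonneg.2 (avoidProb_succ_le hwB hB n)
    have h3 : (avoidProb w A n - avoidEnd w A n i) * (avoidProb w B n - avoidProb w B (n + 1))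
        ≤ τ * (2 * Real.exp (-l * n / 2)) := by
      -- The decrement bound looks two letters back; at `n = 0` the decrement vanishes.
      match n with
      | 0 => simp [avoidProb_one]; positivity
      | m + 1 =>
        calc _ ≤ avoidProb w A m * (τ * avoidProb w B m) := by
              refine mul_le_mul ?_ (avoidProb_sub_succ_succ_le hwB hB m) h2
                (avoidProb_nonneg hwA hA m)
              linarith [avoidEnd_nonneg hwA hA (m + 1) hi, avoidProb_succ_le hwA hA m]
          _ = τ * (avoidProb w A m * avoidProb w B m) := by ring
          _ ≤ _ := mul_le_mul_of_nonneg_left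
              ((avoidProb_mul_le hwA hA hwB hB hl m).trans (exp_shift_le hl2 m)) hτ0
    rw [e, abs_mul, abs_of_nonneg hw]
    have h4 := hstep n
    have h5 := abs_sub ((avoidProb w A n - avoidEnd w A n i)
              * (avoidProb w B n - avoidProb w B (n + 1)))
            (alternatingTail (fun n => avoidProb w A n * avoidProb w B n) (w i) n
              - avoidEnd w A n i * avoidProb w B n)
    rw [abs_of_nonneg (mul_nonneg h1 h2)] at h5
    -- The constant `8` closes the induction: forcing `2` plus `8 * (1 / 2)` gives `6`, and one step
    -- of decay costs `4 / 3`.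
    have h6 : 8 * w i * τ * Real.exp (-l * n / 2) ≤ τ * (4 * Real.exp (-l * n / 2)) := by
      nlinarith [mul_nonneg hτ0 (Real.exp_pos (-l * n / 2)).le]
    calc _ ≤ w i * (τ * (6 * Real.exp (-l * n / 2))) := by
          gcongr
          linarith
      _ ≤ w i * (τ * (6 * (4 / 3 * Real.exp (-l * (n + 1 : ℕ) / 2)))) := by gcongr
      _ = _ := by ring

lemma abs_avoidDefect_mul_le (hAB : Disjoint A B)
    (hwA : ∀ i ∈ A, 0 ≤ w i) (hA : ∑ i ∈ A, w i ≤ 1)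
    (hwB : ∀ i ∈ B, 0 ≤ w i) (hB : ∑ i ∈ B, w i ≤ 1)
    {l : ℝ} (hl : l = ∑ i ∈ A, w i ^ 2 + ∑ i ∈ B, w i ^ 2) (hl2 : l ≤ 1 / 2)
    (hA2 : ∀ i ∈ A, w i ≤ 1 / 2) (hB2 : ∀ i ∈ B, w i ≤ 1 / 2) (n : ℕ) :
    |avoidDefect w (A ∪ B) (fun n => avoidProb w A n * avoidProb w B n) n|
      ≤ 18 * (∑ i ∈ A, w i ^ 2) * (∑ i ∈ B, w i ^ 2) * Real.exp (-l * n / 2) := by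
  have hσ0 : 0 ≤ ∑ i ∈ A, w i ^ 2 := Finset.sum_nonneg fun i _ => sq_nonneg _
  have hτ0 : 0 ≤ ∑ i ∈ B, w i ^ 2 := Finset.sum_nonneg fun i _ => sq_nonneg _
  have hcomm : (fun n => avoidProb w A n * avoidProb w B n)
      = fun n => avoidProb w B n * avoidProb w A n := funext fun _ => mul_comm _ _
  have h1 : |∑ i ∈ A, w i * (alternatingTail (fun n => avoidProb w A n * avoidProb w B n) (w i) n
            - avoidEnd w A n i * avoidProb w B n)|
      ≤ (∑ i ∈ A, w i ^ 2) * (8 * (∑ i ∈ B, w i ^ 2) * Real.exp (-l * n / 2)) := by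
    rw [Finset.sum_mul]
    refine (Finset.abs_sum_le_sum_abs _ _).trans (Finset.sum_le_sum fun i hi => ?_)
    rw [abs_mul, abs_of_nonneg (hwA i hi), sq, mul_assoc]
    refine mul_le_mul_of_nonneg_left ?_ (hwA i hi)
    exact (abs_alternatingTail_sub_le hwA hA hwB hB hl hl2 hi (hA2 i hi) n).trans_eq (by ring)
  have h2 : |∑ i ∈ B, w i * (alternatingTail (fun n => avoidProb w A n * avoidProb w B n) (w i) n
            - avoidEnd w B n i * avoidProb w A n)|
      ≤ (∑ i ∈ B, w i ^ 2) * (8 * (∑ i ∈ A, w i ^ 2) * Real.exp (-l * n / 2)) := by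
    rw [Finset.sum_mul, hcomm]
    refine (Finset.abs_sum_le_sum_abs _ _).trans (Finset.sum_le_sum fun i hi => ?_)
    rw [abs_mul, abs_of_nonneg (hwB i hi), sq, mul_assoc]
    refine mul_le_mul_of_nonneg_left ?_ (hwB i hi)
    exact (abs_alternatingTail_sub_le hwB hB hwA hA (hl.trans (add_comm _ _)) hl2 hi
      (hB2 i hi) n).trans_eq (by ring)
  have h3 : |(avoidProb w A n - avoidProb w A (n + 1)) * (avoidProb w B n - avoidProb w B (n + 1))|
      ≤ 2 * (∑ i ∈ A, w i ^ 2) * (∑ i ∈ B, w i ^ 2) * Real.exp (-l * n / 2) := by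
    have hfA := sub_nonneg.2 (avoidProb_succ_le hwA hA n)
    have hfB := sub_nonneg.2 (avoidProb_succ_le hwB hB n)
    rw [abs_of_nonneg (mul_nonneg hfA hfB)]
    match n with
    | 0 => simp [avoidProb_one]; positivity
    | m + 1 =>
      have hm := (avoidProb_mul_le hwA hA hwB hB hl m).trans (exp_shift_le hl2 m)
      calc _ ≤ ((∑ i ∈ A, w i ^ 2) * avoidProb w A m) * ((∑ i ∈ B, w i ^ 2) * avoidProb w B m) :=
            mul_le_mul (avoidProb_sub_succ_succ_le hwA hA m)
              (avoidProb_sub_succ_succ_le hwB hB m) hfB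
              (mul_nonneg hσ0 (avoidProb_nonneg hwA hA m))
        _ = ((∑ i ∈ A, w i ^ 2) * (∑ i ∈ B, w i ^ 2)) * (avoidProb w A m * avoidProb w B m) := by
            ring
        _ ≤ ((∑ i ∈ A, w i ^ 2) * (∑ i ∈ B, w i ^ 2))
              * (2 * Real.exp (-l * (m + 1 : ℕ) / 2)) := by gcongr
        _ = _ := by ring
  rw [avoidDefect_mul hAB]
  refine (abs_add_three _ _ _).trans ?_
  linarith

lemma abs_avoidProb_mul_sub_le_of_le_half (hAB : Disjoint A B)
    (hw : ∀ i ∈ A ∪ B, 0 ≤ w i) (hs : ∑ i ∈ A ∪ B, w i ≤ 1)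
    (hw2 : ∀ i ∈ A ∪ B, w i ≤ 1 / 2) {n : ℕ} (hn : 1 ≤ n) :
    |avoidProb w A n * avoidProb w B n - avoidProb w (A ∪ B) n| ≤ 72 / n := by
  have hwA : ∀ i ∈ A, 0 ≤ w i := fun i hi => hw i (Finset.mem_union_left _ hi)
  have hwB : ∀ i ∈ B, 0 ≤ w i := fun i hi => hw i (Finset.mem_union_right _ hi)
  have hA : ∑ i ∈ A, w i ≤ 1 := (Finset.sum_le_sum_of_subset_of_nonneg
    Finset.subset_union_left fun i hi _ => hw i hi).trans hs
  have hB : ∑ i ∈ B, w i ≤ 1 := (Finset.sum_le_sum_of_subset_of_nonneg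
    Finset.subset_union_right fun i hi _ => hw i hi).trans hs
  obtain ⟨l, hl⟩ : ∃ l, l = ∑ i ∈ A, w i ^ 2 + ∑ i ∈ B, w i ^ 2 := ⟨_, rfl⟩
  have hlu : l = ∑ i ∈ A ∪ B, w i ^ 2 := by rw [hl, Finset.sum_union hAB]
  have hσ0 : 0 ≤ ∑ i ∈ A, w i ^ 2 := Finset.sum_nonneg fun i _ => sq_nonneg _
  have hτ0 : 0 ≤ ∑ i ∈ B, w i ^ 2 := Finset.sum_nonneg fun i _ => sq_nonneg _
  have hl0 : 0 ≤ l := by rw [hl]; positivity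
  have hl2 : l ≤ 1 / 2 := by
    rw [hlu]
    calc ∑ i ∈ A ∪ B, w i ^ 2 ≤ ∑ i ∈ A ∪ B, w i * (1 / 2) :=
          Finset.sum_le_sum fun i hi => by nlinarith [hw i hi, hw2 i hi]
      _ ≤ _ := by rw [← Finset.sum_mul]; linarith
  have hA2 : ∀ i ∈ A, w i ≤ 1 / 2 := fun i hi => hw2 i (Finset.mem_union_left _ hi)
  have hB2 : ∀ i ∈ B, w i ≤ 1 / 2 := fun i hi => hw2 i (Finset.mem_union_right _ hi)
  have hn0 : (0 : ℝ) < n := by exact_mod_cast hn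
  have h1 : |avoidProb w A n * avoidProb w B n - avoidProb w (A ∪ B) n|
      ≤ n * (36 * ((∑ i ∈ A, w i ^ 2) * (∑ i ∈ B, w i ^ 2)) * Real.exp (-l * n / 2)) := by
    rw [(sub_avoidProb_eq_sum_avoidDefect (A := A ∪ B) (w := w)
      (fun n => avoidProb w A n * avoidProb w B n) (by simp) n).1]
    refine (Finset.abs_sum_le_sum_abs _ _).trans ?_
    rw [← nsmul_eq_mul]
    -- The exponentials at times `k` and `n - 1 - k` multiply to a bound free of `k`, so all `n`
    -- terms share it.
    refine (Finset.sum_le_card_nsmul _ _ _ fun k hk => ?_).trans_eq (by rw [Finset.card_range])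
    have hk' := Finset.mem_range.1 hk
    rw [abs_mul, abs_of_nonneg (avoidProb_nonneg hw hs _)]
    have hc : ((n - 1 - k : ℕ) : ℝ) = n - 1 - k := by
      rw [Nat.sub_sub, Nat.cast_sub (by omega)]; push_cast; ring
    have hsq := exp_le_two hl2
    calc _ ≤ (18 * (∑ i ∈ A, w i ^ 2) * (∑ i ∈ B, w i ^ 2) * Real.exp (-l * k / 2))
          * Real.exp (-l * ((n - 1 - k : ℕ) - 1) / 2) := by
          refine mul_le_mul (abs_avoidDefect_mul_le hAB hwA hA hwB hB hl hl2 hA2 hB2 k) ?_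
            (avoidProb_nonneg hw hs _) (by positivity)
          rw [hlu]
          exact avoidProb_le_exp hw hs _
      _ = 18 * ((∑ i ∈ A, w i ^ 2) * (∑ i ∈ B, w i ^ 2)) *
            (Real.exp l * Real.exp (-l * n / 2)) := by
          rw [mul_assoc, ← Real.exp_add, ← Real.exp_add, hc, mul_assoc 18]
          congr 2; ring
      _ ≤ 18 * ((∑ i ∈ A, w i ^ 2) * (∑ i ∈ B, w i ^ 2)) *
            (2 * Real.exp (-l * n / 2)) := by gcongr
      _ = _ := by ring
  have h2 : (∑ i ∈ A, w i ^ 2) * (∑ i ∈ B, w i ^ 2) ≤ l ^ 2 / 4 := by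
    rw [hl]; nlinarith [sq_nonneg (∑ i ∈ A, w i ^ 2 - ∑ i ∈ B, w i ^ 2)]
  -- From `x ^ 2 / 2 ≤ exp x` at `x = l * n / 2`; hence `72 = 36 / 4 * 8`.
  have h3 : l ^ 2 * n ^ 2 * Real.exp (-l * n / 2) ≤ 8 := by
    have hq := Real.quadratic_le_exp_of_nonneg (x := l * n / 2) (by positivity)
    have he : Real.exp (-l * n / 2) * Real.exp (l * n / 2) = 1 := by
      rw [← Real.exp_add]; simp [neg_div, neg_mul]
    have hx : 0 ≤ l * n := by positivity
    calc _ ≤ (8 * Real.exp (l * n / 2)) * Real.exp (-l * n / 2) := by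
          refine mul_le_mul_of_nonneg_right ?_ (Real.exp_pos _).le
          nlinarith
      _ = 8 := by rw [mul_assoc, mul_comm (Real.exp (l * n / 2)), he, mul_one]
  refine h1.trans ?_
  rw [le_div_iff₀ hn0]
  calc _ ≤ n * (36 * (l ^ 2 / 4) * Real.exp (-l * n / 2)) * n := by gcongr
    _ = 9 * (l ^ 2 * n ^ 2 * Real.exp (-l * n / 2)) := by ring
    _ ≤ 72 := by linarith

/-- A heavy letter forces the sum of squares to be at least `1 / 4`, giving decay at a fixed
exponential rate. -/
lemma avoidProb_le_of_half_le (hw : ∀ i ∈ A, 0 ≤ w i) (hs : ∑ i ∈ A, w i ≤ 1) {i : ℕ}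
    (hi : i ∈ A) (hi2 : 1 / 2 ≤ w i) {n : ℕ} (hn : 1 ≤ n) : avoidProb w A n ≤ 72 / n := by
  have hn0 : (1 : ℝ) ≤ n := by exact_mod_cast hn
  have hσ : 1 / 4 ≤ ∑ i ∈ A, w i ^ 2 :=
    le_trans (by nlinarith) (Finset.single_le_sum (fun i _ => sq_nonneg (w i)) hi)
  calc avoidProb w A n ≤ Real.exp (-(∑ i ∈ A, w i ^ 2) * ((n : ℝ) - 1) / 2) :=
        avoidProb_le_exp hw hs n
    _ ≤ Real.exp (-((n - 1) / 8)) := Real.exp_le_exp.2 (by nlinarith)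
    _ ≤ 72 / n := by
        have h := Real.add_one_le_exp ((n - 1 : ℝ) / 8)
        rw [Real.exp_neg, inv_le_comm₀ (Real.exp_pos _) (by positivity), inv_div]
        linarith

theorem abs_avoidProb_mul_sub_le (hAB : Disjoint A B)
    (hw : ∀ i ∈ A ∪ B, 0 ≤ w i) (hs : ∑ i ∈ A ∪ B, w i ≤ 1) {n : ℕ} (hn : 1 ≤ n) :
    |avoidProb w A n * avoidProb w B n - avoidProb w (A ∪ B) n| ≤ 72 / n := by
  by_cases hw2 : ∀ i ∈ A ∪ B, w i ≤ 1 / 2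
  · exact abs_avoidProb_mul_sub_le_of_le_half hAB hw hs hw2 hn
  push Not at hw2
  obtain ⟨i, hi, hi2⟩ := hw2
  have hwA : ∀ i ∈ A, 0 ≤ w i := fun i hi => hw i (Finset.mem_union_left _ hi)
  have hwB : ∀ i ∈ B, 0 ≤ w i := fun i hi => hw i (Finset.mem_union_right _ hi)
  have hA : ∑ i ∈ A, w i ≤ 1 := (Finset.sum_le_sum_of_subset_of_nonneg
    Finset.subset_union_left fun i hi _ => hw i hi).trans hs
  have hB : ∑ i ∈ B, w i ≤ 1 := (Finset.sum_le_sum_of_subset_of_nonneg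
    Finset.subset_union_right fun i hi _ => hw i hi).trans hs
  have hA0 := avoidProb_nonneg hwA hA n
  have hB0 := avoidProb_nonneg hwB hB n
  refine abs_sub_le_of_nonneg_of_le (mul_nonneg hA0 hB0) ?_ (avoidProb_nonneg hw hs n)
    (avoidProb_le_of_half_le hw hs hi hi2.le hn)
  rcases Finset.mem_union.1 hi with h | h
  · exact (mul_le_of_le_one_right hA0 (avoidProb_le_one hwB hB n)).trans
      (avoidProb_le_of_half_le hwA hA h hi2.le hn)
  · exact (mul_le_of_le_one_left hB0 (avoidProb_le_one hwA hA n)).trans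
      (avoidProb_le_of_half_le hwB hB h hi2.le hn)

theorem abs_avoidProb_sub_prod_le (hw : ∀ i ∈ A, 0 ≤ w i) (hs : ∑ i ∈ A, w i ≤ 1) {n : ℕ}
    (hn : 1 ≤ n) : |avoidProb w A n - ∏ i ∈ A, avoidProb w {i} n| ≤ A.card * (72 / n) := by
  induction A using Finset.induction_on with
  | empty =>
    have h : ∀ n, avoidProb w ∅ n = 1 := fun n => by
      induction n with
      | zero => simp
      | succ n ih => simp [avoidProb_succ, ih]
    simp [h]
  | insert a A ha ih =>
    have hwA : ∀ i ∈ A, 0 ≤ w i := fun i hi => hw i (Finset.mem_insert_of_mem hi)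
    have hwa : ∀ i ∈ ({a} : Finset ℕ), 0 ≤ w i := by
      intro i hi
      rw [Finset.mem_singleton.1 hi]
      exact hw a (Finset.mem_insert_self a A)
    have hA : ∑ i ∈ A, w i ≤ 1 := (Finset.sum_le_sum_of_subset_of_nonneg
      (Finset.subset_insert a A) fun i hi _ => hw i hi).trans hs
    have ha1 : ∑ i ∈ ({a} : Finset ℕ), w i ≤ 1 := (Finset.sum_le_sum_of_subset_of_nonneg
      (by simp) fun i hi _ => hw i hi).trans hs
    have h1 := abs_avoidProb_mul_sub_le (w := w) (A := {a}) (B := A)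
      (Finset.disjoint_singleton_left.2 ha)
      (by rwa [← Finset.insert_eq]) (by rwa [← Finset.insert_eq]) hn
    rw [← Finset.insert_eq, abs_sub_comm] at h1
    have h2 := ih hwA hA
    have h3 : |avoidProb w {a} n * (avoidProb w A n - ∏ i ∈ A, avoidProb w {i} n)|
        ≤ A.card * (72 / n) := by
      rw [abs_mul, abs_of_nonneg (avoidProb_nonneg hwa ha1 n)]
      exact (mul_le_of_le_one_left (abs_nonneg _) (avoidProb_le_one hwa ha1 n)).trans h2
    rw [Finset.prod_insert ha, Finset.card_insert_of_notMem ha]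
    have e : avoidProb w (insert a A) n - avoidProb w {a} n * ∏ i ∈ A, avoidProb w {i} n
      = (avoidProb w (insert a A) n - avoidProb w {a} n * avoidProb w A n)
        + avoidProb w {a} n * (avoidProb w A n - ∏ i ∈ A, avoidProb w {i} n) := by ring
    rw [e]
    refine (abs_add_le _ _).trans ?_
    push_cast
    linarith

end Product

/-! ### Events determined by a prefix of the string. -/

/-- No pair `ii` with `i ∈ A` occurs among the first `n` letters of `y`. -/
def NoRepeat (A : Finset ℕ) (n : ℕ) (y : ℕ → ℕ) : Prop :=
  ∀ a, a + 1 < n → ∀ i ∈ A, ¬(y a = i ∧ y (a + 1) = i)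

/-- The last of the first `n` letters of `y` is `i`. -/
def EndsWith (n i : ℕ) (y : ℕ → ℕ) : Prop := ∃ m, m + 1 = n ∧ y m = i

/-- A string of length `n`, prolonged by zeros. -/
def extendString {Ω : Type*} {n : ℕ} (Z : Fin n → Ω → ℕ) (ω : Ω) (m : ℕ) : ℕ :=
  if h : m < n then Z ⟨m, h⟩ ω else 0

/-- The property `P` of sequences depends only on the first `j` terms. -/
def DependsOnPrefix (j : ℕ) (P : (ℕ → ℕ) → Prop) : Prop :=
  ∀ y y' : ℕ → ℕ, (∀ m < j, y m = y' m) → P y → P y'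

lemma dependsOnPrefix_noRepeat (A : Finset ℕ) (n : ℕ) : DependsOnPrefix n (NoRepeat A n) := by
  intro y y' h hP a ha i hi
  rw [← h a (by omega), ← h (a + 1) ha]
  exact hP a ha i hi

lemma dependsOnPrefix_endsWith (n i : ℕ) : DependsOnPrefix n (EndsWith n i) := by
  rintro y y' h ⟨m, hm, hy⟩
  exact ⟨m, hm, by rw [← h m (by omega), hy]⟩

lemma DependsOnPrefix.and {j : ℕ} {P Q : (ℕ → ℕ) → Prop} (hP : DependsOnPrefix j P)
    (hQ : DependsOnPrefix j Q) : DependsOnPrefix j fun y => P y ∧ Q y :=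
  fun y y' h hy => ⟨hP y y' h hy.1, hQ y y' h hy.2⟩

lemma noRepeat_succ_iff {A : Finset ℕ} {n : ℕ} {y : ℕ → ℕ} :
    NoRepeat A (n + 1) y ↔ NoRepeat A n y ∧ ¬ ∃ i ∈ A, EndsWith n i y ∧ y n = i := by
  constructor
  · refine fun h => ⟨fun a ha => h a (by omega), ?_⟩
    rintro ⟨i, hi, ⟨m, rfl, hm⟩, hn⟩
    exact h m (by omega) i hi ⟨hm, hn⟩
  · rintro ⟨h, h'⟩ a ha i hi ⟨h1, h2⟩
    rcases Nat.lt_or_ge (a + 1) n with hlt | hge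
    · exact h a hlt i hi ⟨h1, h2⟩
    · obtain rfl : a + 1 = n := by omega
      exact h' ⟨i, hi, ⟨a, rfl, h1⟩, h2⟩

section Strings

variable {Ω : Type*} {n : ℕ} {Z : Fin n → Ω → ℕ}

lemma extendString_eq {j : ℕ} (hj : j < n) (ω : Ω) : extendString Z ω j = Z ⟨j, hj⟩ ω := by
  simp [extendString, hj]

lemma pairIndicator_eq_zero_iff {i j : ℕ} {ω : Ω} :
    pairIndicator Z i j ω = 0 ↔ ¬ PairAppears (fun m => Z m ω) i j := by
  simp [pairIndicator]

lemma pairIndicator_eq_one_iff {i j : ℕ} {ω : Ω} :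
    pairIndicator Z i j ω = 1 ↔ ¬ pairIndicator Z i j ω = 0 := by
  simp [pairIndicator]

lemma noRepeat_extendString_iff {A : Finset ℕ} {ω : Ω} :
    NoRepeat A n (extendString Z ω) ↔ ∀ i ∈ A, pairIndicator Z i i ω = 0 := by
  simp only [pairIndicator_eq_zero_iff, PairAppears, NoRepeat]
  constructor
  · rintro h i hi ⟨a, b, hab, h1, h2⟩
    refine h a (hab ▸ b.2) i hi ⟨by rw [extendString_eq a.2]; exact h1, ?_⟩
    rw [extendString_eq (hab ▸ b.2 : (a : ℕ) + 1 < n), ← h2]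
    exact congrArg (Z · ω) (Fin.ext hab.symm)
  · rintro h a ha i hi ⟨h1, h2⟩
    rw [extendString_eq (by omega)] at h1
    rw [extendString_eq ha] at h2
    exact h i hi ⟨⟨a, by omega⟩, ⟨a + 1, ha⟩, rfl, h1, h2⟩

/-- Puts a prefix event in the form required by independence of disjoint blocks of letters. -/
lemma DependsOnPrefix.exists_preimage {j : ℕ} {P : (ℕ → ℕ) → Prop} (hP : DependsOnPrefix j P)
    (Z : Fin n → Ω → ℕ) :
    ∃ T : Set ((Finset.univ.filter fun m : Fin n => (m : ℕ) < j) → ℕ),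
      {ω | P (extendString Z ω)} =
      (fun ω (m : (Finset.univ.filter fun m : Fin n => (m : ℕ) < j)) => Z m ω) ⁻¹' T := by
  refine ⟨{v | P fun m => if h : ∃ hm : m < n, m < j then
    v ⟨⟨m, h.1⟩, by simpa using h.2⟩ else 0}, ?_⟩
  have key : ∀ ω, ∀ m < j, extendString Z ω m = if h : ∃ hm : m < n, m < j then
      Z ⟨m, h.1⟩ ω else 0 := by
    intro ω m hm
    by_cases hmn : m < n <;> simp [extendString, hmn, hm]
  ext ω
  exact ⟨hP _ _ (key ω), hP _ _ fun m hm => (key ω m hm).symm⟩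

end Strings

lemma sum_geometric_le_one {p : ℝ} (hp0 : 0 < p) (hp1 : p < 1) {A : Finset ℕ} (hA : ∀ i ∈ A, 1 ≤ i) :
    ∑ i ∈ A, p * (1 - p) ^ (i - 1) ≤ 1 := by
  have hinj : Set.InjOn (fun i => i - 1) (A : Set ℕ) := fun i hi j hj h => by
    have := hA i hi
    have := hA j hj
    simp only at h
    omega
  rw [← Finset.mul_sum, ← Finset.sum_image (f := fun m => (1 - p) ^ m) hinj]
  have hs := (hasSum_geometric_of_lt_one (r := 1 - p) (by linarith) (by linarith))
  have h := sum_le_hasSum (A.image fun i => i - 1)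
    (fun i _ => pow_nonneg (by linarith : (0 : ℝ) ≤ 1 - p) i) hs
  rw [sub_sub_cancel] at h
  calc _ ≤ p * p⁻¹ := by gcongr
    _ = 1 := mul_inv_cancel₀ hp0.ne'

/-! ### From the random string to the recursion, and from zeros to arbitrary values. -/

section Probability

variable {Ω : Type*} [MeasurableSpace Ω] {μ : Measure Ω} {p : ℝ} {n : ℕ} {Z : Fin n → Ω → ℕ}

lemma measurable_extendString (hZ : ∀ m, Measurable (Z m)) (j : ℕ) :
    Measurable fun ω => extendString Z ω j := by
  by_cases h : j < n
  · simpa [extendString, h] using hZ ⟨j, h⟩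
  · simp [extendString, h]

lemma DependsOnPrefix.measurableSet {j : ℕ} {P : (ℕ → ℕ) → Prop} (hP : DependsOnPrefix j P)
    (hZ : ∀ m, Measurable (Z m)) : MeasurableSet {ω | P (extendString Z ω)} := by
  obtain ⟨T, hT⟩ := hP.exists_preimage Z
  rw [hT]
  refine measurableSet_preimage (measurable_pi_lambda _ fun m => ?_) MeasurableSet.of_discrete
  exact hZ m

lemma IsGeometricString.real_prefix_and [IsProbabilityMeasure μ] (hZ : IsGeometricString μ p Z)
    {j : ℕ} (hj : j < n) {P : (ℕ → ℕ) → Prop} (hP : DependsOnPrefix j P) {i : ℕ} (hi : 1 ≤ i) :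
    μ.real {ω | P (extendString Z ω) ∧ extendString Z ω j = i}
      = μ.real {ω | P (extendString Z ω)} * (p * (1 - p) ^ (i - 1)) := by
  obtain ⟨T, hT⟩ := hP.exists_preimage Z
  have hind := hZ.indep.indepFun_finset (Finset.univ.filter fun m : Fin n => (m : ℕ) < j)
    {⟨j, hj⟩} (by simp) hZ.measurable
  have h := hind.measure_inter_preimage_eq_mul T
    {v | v ⟨⟨j, hj⟩, Finset.mem_singleton_self _⟩ = i} MeasurableSet.of_discrete
    MeasurableSet.of_discrete
  rw [← hT] at h
  rw [← hZ.law ⟨j, hj⟩ i hi, measureReal_def, measureReal_def, measureReal_def,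
    ← ENNReal.toReal_mul]
  simp only [extendString_eq hj]
  exact congrArg ENNReal.toReal h

/-- Letter `j` (counted from `0`) is independent of the prefix, so removing the events where it
repeats the previous letter reproduces both recursion equations. -/
lemma IsGeometricString.real_noRepeat [IsProbabilityMeasure μ] (hZ : IsGeometricString μ p Z)
    {A : Finset ℕ} (hA : ∀ i ∈ A, 1 ≤ i) {j : ℕ} (hj : j ≤ n) :
    μ.real {ω | NoRepeat A j (extendString Z ω)}
        = avoidProb (fun i => p * (1 - p) ^ (i - 1)) A j ∧
      ∀ i ∈ A, μ.real {ω | NoRepeat A j (extendString Z ω) ∧ EndsWith j i (extendString Z ω)}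
        = avoidEnd (fun i => p * (1 - p) ^ (i - 1)) A j i := by
  induction j with
  | zero => simp [NoRepeat, EndsWith]
  | succ j ih =>
    obtain ⟨ih1, ih2⟩ := ih (by omega)
    have hjn : j < n := hj
    have hEL := fun i =>
      ((dependsOnPrefix_noRepeat A j).and (dependsOnPrefix_endsWith j i)).measurableSet
        hZ.measurable
    have hELL : ∀ i, MeasurableSet {ω |
        (NoRepeat A j (extendString Z ω) ∧ EndsWith j i (extendString Z ω)) ∧
          extendString Z ω j = i} := fun i =>
      (hEL i).inter <| measurable_extendString hZ.measurable j (measurableSet_singleton i)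
    have hstep := fun i (hi : i ∈ A) => hZ.real_prefix_and hjn
      ((dependsOnPrefix_noRepeat A j).and (dependsOnPrefix_endsWith j i)) (hA i hi)
    constructor
    · have hset : {ω | NoRepeat A (j + 1) (extendString Z ω)}
          = {ω | NoRepeat A j (extendString Z ω)} \ ⋃ i ∈ A,
            {ω | (NoRepeat A j (extendString Z ω) ∧ EndsWith j i (extendString Z ω)) ∧
              extendString Z ω j = i} := by
        ext ω
        simp only [Set.mem_ofPred_eq, noRepeat_succ_iff, Set.mem_sdiff, Set.mem_iUnion]
        constructor
        · rintro ⟨h1, h2⟩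
          exact ⟨h1, fun ⟨i, hi, h, h'⟩ => h2 ⟨i, hi, h.2, h'⟩⟩
        · rintro ⟨h1, h2⟩
          exact ⟨h1, fun ⟨i, hi, h, h'⟩ => h2 ⟨i, hi, ⟨h1, h⟩, h'⟩⟩
      rw [hset, measureReal_sdiff, measureReal_biUnion_finset, avoidProb_succ, ih1]
      · congr 1
        refine Finset.sum_congr rfl fun i hi => ?_
        rw [hstep i hi, ih2 i hi, mul_comm]
      · intro i _ k _ hik
        refine Set.disjoint_left.2 fun ω h1 h2 => hik ?_
        exact h1.2.symm.trans h2.2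
      · exact fun i _ => hELL i
      · exact Set.iUnion₂_subset fun i _ ω h => h.1.1
      · exact Finset.measurableSet_biUnion _ fun i _ => hELL i
    · intro i hi
      have hset : {ω | NoRepeat A (j + 1) (extendString Z ω) ∧
            EndsWith (j + 1) i (extendString Z ω)}
          = {ω | NoRepeat A j (extendString Z ω) ∧ extendString Z ω j = i} \
            {ω | (NoRepeat A j (extendString Z ω) ∧ EndsWith j i (extendString Z ω)) ∧
              extendString Z ω j = i} := by
        ext ω
        have hend : EndsWith (j + 1) i (extendString Z ω) ↔ extendString Z ω j = i := by
          simp [EndsWith]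
        simp only [Set.mem_ofPred_eq, noRepeat_succ_iff, Set.mem_sdiff, hend]
        constructor
        · rintro ⟨⟨h1, h2⟩, h3⟩
          exact ⟨⟨h1, h3⟩, fun h => h2 ⟨i, hi, h.1.2, h3⟩⟩
        · rintro ⟨⟨h1, h3⟩, h2⟩
          refine ⟨⟨h1, ?_⟩, h3⟩
          rintro ⟨k, _, h5, h6⟩
          obtain rfl : k = i := h6.symm.trans h3
          exact h2 ⟨⟨h1, h5⟩, h3⟩
      rw [hset, measureReal_sdiff ?_ (hELL i), hstep i hi,
        hZ.real_prefix_and hjn (dependsOnPrefix_noRepeat A j) (hA i hi), ih1, ih2 i hi,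
        avoidEnd_succ]
      · ring
      · exact fun ω h => ⟨h.1.1, h.2⟩

lemma IsGeometricString.abs_real_forall_eq_zero_sub_prod_le [IsProbabilityMeasure μ]
    (hp0 : 0 < p) (hp1 : p < 1) (hZ : IsGeometricString μ p Z) (hn : 1 ≤ n)
    {A : Finset ℕ} (hA : ∀ i ∈ A, 1 ≤ i) :
    |μ.real {ω | ∀ i ∈ A, pairIndicator Z i i ω = 0}
        - ∏ i ∈ A, μ.real {ω | pairIndicator Z i i ω = 0}| ≤ A.card * (72 / n) := by
  have h : ∀ B : Finset ℕ, (∀ i ∈ B, 1 ≤ i) →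
      μ.real {ω | ∀ i ∈ B, pairIndicator Z i i ω = 0}
        = avoidProb (fun i => p * (1 - p) ^ (i - 1)) B n := fun B hB => by
    simpa only [noRepeat_extendString_iff] using (hZ.real_noRepeat hB le_rfl).1
  have hsingle : ∀ i ∈ A, μ.real {ω | pairIndicator Z i i ω = 0}
      = avoidProb (fun i => p * (1 - p) ^ (i - 1)) {i} n := fun i hi => by
    simpa using h {i} (by simpa using hA i hi)
  rw [h A hA, Finset.prod_congr rfl hsingle]
  exact abs_avoidProb_sub_prod_le
    (fun i _ => mul_nonneg hp0.le (pow_nonneg (by linarith) _))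
    (sum_geometric_le_one hp0 hp1 hA) hn

/-- Approximate factorization of all intersections of the events `E i`, `i ∈ I`, gives approximate
factorization of the intersections of these events and their complements. -/
lemma abs_real_inter_compl_sub_prod_le [IsProbabilityMeasure μ] {ι : Type*} [DecidableEq ι]
    {E : ι → Set Ω} (hE : ∀ i, MeasurableSet (E i)) {I : Finset ι} {ε : ℝ}
    (h : ∀ A ⊆ I, |μ.real (⋂ i ∈ A, E i) - ∏ i ∈ A, μ.real (E i)| ≤ ε)
    (B : Finset ι) : ∀ A : Finset ι, Disjoint A B → A ∪ B ⊆ I →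
    |μ.real ((⋂ i ∈ A, E i) ∩ ⋂ i ∈ B, (E i)ᶜ)
      - (∏ i ∈ A, μ.real (E i)) * ∏ i ∈ B, μ.real (E i)ᶜ| ≤ 2 ^ B.card * ε := by
  induction B using Finset.induction_on with
  | empty => intro A _ hA; simpa using h A (by simpa using hA)
  | insert b B hb ih =>
    intro A hAB hI
    have hbA : b ∉ A := fun hbA => Finset.disjoint_left.1 hAB hbA (Finset.mem_insert_self _ _)
    have h1 := ih A (hAB.mono_right (Finset.subset_insert _ _))
      ((Finset.union_subset_union_right (Finset.subset_insert _ _)).trans hI)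
    have h2 := ih (insert b A)
      (Finset.disjoint_insert_left.2 ⟨hb, hAB.mono_right (Finset.subset_insert _ _)⟩)
      (by rwa [Finset.insert_union, ← Finset.union_insert])
    -- Complementing one more event is a difference of two cases already treated, so the error
    -- doubles.
    have e : μ.real ((⋂ i ∈ A, E i) ∩ ⋂ i ∈ insert b B, (E i)ᶜ)
        = μ.real ((⋂ i ∈ A, E i) ∩ ⋂ i ∈ B, (E i)ᶜ)
          - μ.real ((⋂ i ∈ insert b A, E i) ∩ ⋂ i ∈ B, (E i)ᶜ) := by
      rw [eq_sub_iff_add_eq, ← measureReal_inter_add_sdiff (s := (⋂ i ∈ A, E i) ∩ ⋂ i ∈ B, (E i)ᶜ)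
        (hE b), add_comm]
      congr 2
      · ext ω; simp; tauto
      · ext ω; simp; tauto
    rw [e, Finset.prod_insert hb, probReal_compl_eq_one_sub (hE b),
      Finset.card_insert_of_notMem hb, pow_succ]
    rw [Finset.prod_insert hbA] at h2
    have e2 : ∀ x y s t r : ℝ, x - y - s * ((1 - r) * t) = (x - s * t) - (y - r * s * t) := by
      intros; ring
    rw [e2]
    refine (abs_sub _ _).trans ?_
    linarith

end Probability

theorem mainTheorem2 (k : ℕ) :
    ∃ C : ℝ, ∀ p : ℝ, 0 < p → p < 1 →
      ∀ I : Finset ℕ, (∀ i ∈ I, 1 ≤ i) → I.card = k →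
      ∀ x : ℕ → ℕ, (∀ i ∈ I, x i = 0 ∨ x i = 1) →
      ∀ n : ℕ, 1 ≤ n →
      ∀ (Ω : Type*) [MeasurableSpace Ω] (μ : Measure Ω) [IsProbabilityMeasure μ]
        (Z : Fin n → Ω → ℕ), IsGeometricString μ p Z →
        |μ.real {ω | ∀ i ∈ I, pairIndicator Z i i ω = x i}
            - ∏ i ∈ I, μ.real {ω | pairIndicator Z i i ω = x i}| ≤ C / n := by
  -- `72` per letter split off, and a doubling for each index with `x i = 1`.
  refine ⟨2 ^ k * (k * 72), fun p hp0 hp1 I hI hk x hx n hn Ω _ μ _ Z hZ => ?_⟩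
  have hE : ∀ i, MeasurableSet {ω | pairIndicator Z i i ω = 0} := fun i => by
    simpa [noRepeat_extendString_iff] using
      (dependsOnPrefix_noRepeat {i} n).measurableSet hZ.measurable
  have hone : ∀ i ∈ I.filter fun i => ¬ x i = 0, x i = 1 := fun i hi =>
    (hx i (Finset.mem_filter.1 hi).1).resolve_left (Finset.mem_filter.1 hi).2
  have hcompl : ∀ i, {ω | pairIndicator Z i i ω = 1} = {ω | pairIndicator Z i i ω = 0}ᶜ :=
    fun i => Set.ext fun ω => pairIndicator_eq_one_iff
  have h := abs_real_inter_compl_sub_prod_le (μ := μ) hE (I := I) (ε := k * (72 / n))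
    (fun A hA => by
      have h := hZ.abs_real_forall_eq_zero_sub_prod_le hp0 hp1 hn fun i hi => hI i (hA hi)
      have hset : {ω | ∀ i ∈ A, pairIndicator Z i i ω = 0}
          = ⋂ i ∈ A, {ω | pairIndicator Z i i ω = 0} := by ext ω; simp
      rw [← hset]
      refine h.trans ?_
      gcongr
      exact hk ▸ Finset.card_le_card hA)
    (I.filter fun i => ¬ x i = 0) (I.filter fun i => x i = 0)
    (Finset.disjoint_filter_filter_not _ _ _)
    (by rw [Finset.filter_union_filter_not_eq])
  have hset : {ω | ∀ i ∈ I, pairIndicator Z i i ω = x i}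
      = (⋂ i ∈ I.filter fun i => x i = 0, {ω | pairIndicator Z i i ω = 0})
        ∩ ⋂ i ∈ I.filter fun i => ¬ x i = 0, {ω | pairIndicator Z i i ω = 0}ᶜ := by
    simp only [← hcompl]
    ext ω
    simp only [Set.mem_ofPred_eq, Set.mem_inter_iff, Set.mem_iInter]
    constructor
    · exact fun h => ⟨fun i hi => (h i (Finset.mem_filter.1 hi).1).trans (Finset.mem_filter.1 hi).2,
        fun i hi => (h i (Finset.mem_filter.1 hi).1).trans (hone i hi)⟩
    · rintro ⟨h0, h1⟩ i hi
      by_cases hxi : x i = 0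
      · rw [hxi, h0 i (Finset.mem_filter.2 ⟨hi, hxi⟩)]
      · have hm : i ∈ I.filter fun i => ¬ x i = 0 := Finset.mem_filter.2 ⟨hi, hxi⟩
        rw [hone i hm, h1 i hm]
  have hprod : ∏ i ∈ I, μ.real {ω | pairIndicator Z i i ω = x i}
      = (∏ i ∈ I.filter fun i => x i = 0, μ.real {ω | pairIndicator Z i i ω = 0})
        * ∏ i ∈ I.filter fun i => ¬ x i = 0, μ.real {ω | pairIndicator Z i i ω = 0}ᶜ := by
    rw [← Finset.prod_filter_mul_prod_filter_not I fun i => x i = 0]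
    congr 1
    · exact Finset.prod_congr rfl fun i hi => by rw [(Finset.mem_filter.1 hi).2]
    · exact Finset.prod_congr rfl fun i hi => by rw [hone i hi, hcompl]
  rw [hset, hprod]
  refine h.trans ?_
  rw [mul_div_assoc, mul_div_assoc]
  gcongr
  · norm_num
  · exact hk ▸ Finset.card_filter_le _ _
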